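/- Let $K$ be a compact connected semisimple Lie group, let $Z\subset K$ be a torus, let $H=C_K(Z)$ be the centralizer of $Z$ in $K$, and let $F=K/H$ be the corresponding (generalized) flag manifold, with its standard smooth structure (the one for which $K\to K/H$ is a smooth submersion); write $\dim_{\mathbb R}F=2n$. Let $J$ be a $K$-invariant (integrable) complex structure on $F$ and let $g$ be a $K$-invariant smooth Riemannian metric on $F$ which is Hermitian with respect to $J$, i.e. $g(JX,JY)=g(X,Y)$. Let $\omega(X,Y)=g(JX,Y)$ be the fundamental $2$-form of $g$. Then $g$ is balanced, that is, $$d(\omega^{\,n-1})=0 \quad\text{on } F$$ (for $n=0$, where $F$ is a point, $\omega^{n-1}$ is read as $1$). -/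

import Mathlib

open scoped Manifold ContDiff

noncomputable section

namespace FlagBalanced

/-! ### Exterior algebra of a real topological vector space -/

section Wedge

variable {V : Type*} [AddCommGroup V] [Module ℝ V] [TopologicalSpace V]

/-- The exterior product of two alternating forms, with the shuffle normalisation
`(a ∧ b)(v₁, …, v_{p+q}) = ∑ sign σ · a(v_{σ 1}, …, v_{σ p}) · b(v_{σ (p+1)}, …, v_{σ (p+q)})`,
the sum being over the `(p, q)`-shuffles `σ`. -/
def wedge {p q : ℕ} (a : V [⋀^Fin p]→L[ℝ] ℝ) (b : V [⋀^Fin q]→L[ℝ] ℝ) :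
    V [⋀^Fin (p + q)]→L[ℝ] ℝ :=
  { ((LinearMap.mul' ℝ ℝ).compAlternatingMap
      (a.toAlternatingMap.domCoprod b.toAlternatingMap)).domDomCongr finSumFinEquiv with
    cont := by
      change Continuous fun v : Fin (p + q) → V =>
        (LinearMap.mul' ℝ ℝ) ((a.toAlternatingMap.domCoprod b.toAlternatingMap)
          (fun i => v (finSumFinEquiv i)))
      simp only [AlternatingMap.domCoprod_apply, sum_apply, map_sum]
      refine continuous_finsetSum _ fun σ _ => ?_
      induction σ using Quotient.inductionOn' with | _ σ
      simp only [AlternatingMap.domCoprod.summand_mk'', smul_apply,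
        MultilinearMap.domDomCongr_apply, MultilinearMap.domCoprod_apply]
      simp only [Units.smul_def, map_zsmul, LinearMap.mul'_apply]
      refine Continuous.zsmul (Continuous.mul ?_ ?_) _
      · exact a.cont.comp (continuous_pi fun i => continuous_apply _)
      · exact b.cont.comp (continuous_pi fun i => continuous_apply _) }

/-- The exterior power `w ^ k = w ∧ ⋯ ∧ w` (`k` factors) of a `2`-form `w`, with `w ^ 0 = 1`. -/
def wedgePow (w : V [⋀^Fin 2]→L[ℝ] ℝ) : (k : ℕ) → V [⋀^Fin (2 * k)]→L[ℝ] ℝ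
  | 0 => ContinuousAlternatingMap.constOfIsEmpty ℝ V (Fin 0) 1
  | k + 1 => wedge (wedgePow w k) w

end Wedge

/-! ### Differential forms and the exterior derivative on a manifold -/

section Manifold

variable {E : Type*} [NormedAddCommGroup E] [NormedSpace ℝ E]

/-- Differential `k`-forms (without regularity) on a manifold modelled on `E`. -/
abbrev DiffForm (E : Type*) [NormedAddCommGroup E] [NormedSpace ℝ E]
    (M : Type*) [TopologicalSpace M] [ChartedSpace E M] (k : ℕ) : Type _ :=
  (x : M) → TangentSpace 𝓘(ℝ, E) x [⋀^Fin k]→L[ℝ] ℝ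

variable {M : Type*} [TopologicalSpace M] [ChartedSpace E M]

/-- The expression of a differential form in the preferred chart at `x`: the pullback of the form
by the inverse of the chart. -/
def chartForm {k : ℕ} (α : DiffForm E M k) (x : M) (y : E) : E [⋀^Fin k]→L[ℝ] ℝ :=
  (α ((extChartAt 𝓘(ℝ, E) x).symm y)).compContinuousLinearMap
    (mfderiv 𝓘(ℝ, E) 𝓘(ℝ, E) (extChartAt 𝓘(ℝ, E) x).symm y)

/-- The exterior derivative of a differential form on a manifold: at `x`, it is the pullback by the
chart at `x` of the exterior derivative of the expression of the form in this chart. -/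
def extDer {k : ℕ} (α : DiffForm E M k) : DiffForm E M (k + 1) := fun x =>
  (extDeriv (chartForm α x) (extChartAt 𝓘(ℝ, E) x x)).compContinuousLinearMap
    (mfderiv 𝓘(ℝ, E) 𝓘(ℝ, E) (extChartAt 𝓘(ℝ, E) x) x)

variable (E M) in
/-- A (smooth, integrable) complex structure on a manifold: a smooth field `J` of endomorphisms of
the tangent spaces with `J² = -1` and vanishing Nijenhuis tensor. -/
structure ComplexStructure [IsManifold 𝓘(ℝ, E) ∞ M] where
  /-- the endomorphism of each tangent space -/
  J (x : M) : TangentSpace 𝓘(ℝ, E) x →L[ℝ] TangentSpace 𝓘(ℝ, E) x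
  J_J (x : M) (v : TangentSpace 𝓘(ℝ, E) x) : J x (J x v) = -v
  contMDiff : ContMDiff 𝓘(ℝ, E) (𝓘(ℝ, E).prod 𝓘(ℝ, E →L[ℝ] E)) ∞
    (fun x => Bundle.TotalSpace.mk' (E →L[ℝ] E)
      (E := fun x : M => TangentSpace 𝓘(ℝ, E) x →L[ℝ] TangentSpace 𝓘(ℝ, E) x) x (J x))
  nijenhuis (X Y : (x : M) → TangentSpace 𝓘(ℝ, E) x)
    (hX : ContMDiff 𝓘(ℝ, E) 𝓘(ℝ, E).tangent ∞
      (fun x => (⟨x, X x⟩ : TangentBundle 𝓘(ℝ, E) M)))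
    (hY : ContMDiff 𝓘(ℝ, E) 𝓘(ℝ, E).tangent ∞
      (fun x => (⟨x, Y x⟩ : TangentBundle 𝓘(ℝ, E) M))) (x : M) :
    VectorField.mlieBracket 𝓘(ℝ, E) (fun y => J y (X y)) (fun y => J y (Y y)) x
      - J x (VectorField.mlieBracket 𝓘(ℝ, E) (fun y => J y (X y)) Y x)
      - J x (VectorField.mlieBracket 𝓘(ℝ, E) X (fun y => J y (Y y)) x)
      - VectorField.mlieBracket 𝓘(ℝ, E) X Y x = 0

variable [IsManifold 𝓘(ℝ, E) ∞ M]

/-- A smooth Hermitian metric on the complex manifold `(M, J)`: a smooth Riemannian metric `g`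
with `g(Jv, Jw) = g(v, w)`. -/
structure HermitianMetric (C : ComplexStructure E M) where
  /-- the underlying Riemannian metric -/
  g : Bundle.ContMDiffRiemannianMetric 𝓘(ℝ, E) ∞ E (fun x : M => TangentSpace 𝓘(ℝ, E) x)
  compat (x : M) (v w : TangentSpace 𝓘(ℝ, E) x) :
    g.inner x (C.J x v) (C.J x w) = g.inner x v w

/-- The fundamental form `ω(v, w) = g(Jv, w)` of a Hermitian metric. -/
def HermitianMetric.fundamentalForm {C : ComplexStructure E M} (h : HermitianMetric C) :
    DiffForm E M 2 := fun x =>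
  { toFun := fun v => h.g.inner x (C.J x (v 0)) (v 1)
    map_update_add' := fun m i v w => by
      rename_i inst
      cases Subsingleton.elim inst (instDecidableEqFin 2)
      fin_cases i <;> simp
    map_update_smul' := fun m i c v => by
      rename_i inst
      cases Subsingleton.elim inst (instDecidableEqFin 2)
      fin_cases i <;> simp
    map_eq_zero_of_eq' := fun v i j hv hij => by
      have key : ∀ u : TangentSpace 𝓘(ℝ, E) x, h.g.inner x (C.J x u) u = 0 := fun u => by
        have h1 := h.compat x (C.J x u) u
        have h2 := h.g.symm x (C.J x u) u
        rw [C.J_J, map_neg, neg_apply] at h1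
        linarith
      have h01 : v 0 = v 1 := by
        fin_cases i <;> fin_cases j <;> simp_all
      rw [h01]
      exact key _
    cont := by
      have h1 : Continuous fun v : Fin 2 → TangentSpace 𝓘(ℝ, E) x => C.J x (v 0) :=
        (C.J x).continuous.comp (continuous_apply 0)
      have h2 : Continuous fun v : Fin 2 → TangentSpace 𝓘(ℝ, E) x => v 1 := continuous_apply 1
      have h3 : Continuous fun p : E × E =>
          (show E →L[ℝ] E →L[ℝ] ℝ from h.g.inner x) p.1 p.2 :=
        (show E →L[ℝ] E →L[ℝ] ℝ from h.g.inner x).continuous₂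
      exact h3.comp (h1.prodMk h2) }

/-- A Hermitian metric on a manifold of complex dimension `n` is balanced if
`d (ω ^ (n - 1)) = 0`. (For `n = 0` the power is read as `ω ^ 0 = 1`.) -/
def HermitianMetric.IsBalanced {C : ComplexStructure E M} (h : HermitianMetric C) (n : ℕ) : Prop :=
  extDer (fun x => wedgePow (h.fundamentalForm x) (n - 1)) = 0

/-! ### Invariance under a group action -/

/-- `J` is preserved by every transformation `x ↦ a • x` of the group `K`. -/
def ComplexStructure.IsInvariant (C : ComplexStructure E M) (K : Type*) [SMul K M] : Prop :=
  ∀ (a : K) (x : M) (v : TangentSpace 𝓘(ℝ, E) x),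
    mfderiv 𝓘(ℝ, E) 𝓘(ℝ, E) (fun y : M => a • y) x (C.J x v) =
      C.J (a • x) (mfderiv 𝓘(ℝ, E) 𝓘(ℝ, E) (fun y : M => a • y) x v)

/-- `g` is preserved by every transformation `x ↦ a • x` of the group `K`. -/
def HermitianMetric.IsInvariant {C : ComplexStructure E M} (h : HermitianMetric C)
    (K : Type*) [SMul K M] : Prop :=
  ∀ (a : K) (x : M) (v w : TangentSpace 𝓘(ℝ, E) x),
    h.g.inner (a • x) (mfderiv 𝓘(ℝ, E) 𝓘(ℝ, E) (fun y : M => a • y) x v)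
      (mfderiv 𝓘(ℝ, E) 𝓘(ℝ, E) (fun y : M => a • y) x w) = h.g.inner x v w

end Manifold

/-! ### Lie groups -/

section LieGroup

/-- A Lie group is semisimple if its Lie algebra is semisimple. -/
def IsSemisimpleLieGroup (E K : Type*) [NormedAddCommGroup E] [NormedSpace ℝ E]
    [FiniteDimensional ℝ E] [TopologicalSpace K] [ChartedSpace E K] [Group K]
    [LieGroup 𝓘(ℝ, E) ∞ K] : Prop :=
  haveI : LieGroup 𝓘(ℝ, E) (minSmoothness ℝ 3) K := LieGroup.of_le (n := ∞)
    (by rw [minSmoothness_of_isRCLikeNormedField]; exact ENat.LEInfty.out)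
  LieAlgebra.IsSemisimple ℝ (GroupLieAlgebra 𝓘(ℝ, E) K)

/-- A subgroup of a topological group is a torus if it is isomorphic, as a topological group, to a
finite product of circles. -/
def IsTorus {K : Type*} [TopologicalSpace K] [Group K] (Z : Subgroup K) : Prop :=
  ∃ r : ℕ, Nonempty (Z ≃ₜ* (Fin r → Circle))

end LieGroup

end FlagBalanced

end

open scoped Manifold ContDiff

noncomputable section

namespace FlagBalanced

open Filter Topology

/-! Invariance of `J` and `g` makes ω^(n-1) invariant, hence also β = d(ω^(n-1)), so by transitivity
it suffices that β vanishes at the base point o = H. For n ≥ 1, β has degree 2n-1 there, one less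
than the dimension. If β_o ≠ 0, then β_o is the contraction of a volume form with a nonzero vector
v, and any endomorphism A preserving β_o satisfies A v = det(A) v
(`exists_ne_zero_forall_apply_eq_det_smul`). Elements of `Z` act at o by isometries, so their
determinants square to 1; each is a square in the torus, so its determinant is 1 and `Z` fixes v
(`exists_ne_zero_forall_apply_eq`).

But T_oF, the quotient of the Lie algebra of `K` by that of `H`, has no nonzero `Z`-fixed vector
(`eq_zero_of_isotropy_eq`). Lift v to the Lie algebra and average over `Z` to get an `Ad(Z)`-fixed
lift Y. The integral curve through 1 of the left-invariant field of Y commutes with `Z`, so it stays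
near time 0 in C_K(Z) = H and projects to a constant curve; its velocity v is 0. -/

/-! ### Alternating forms of codegree one -/

section CodegreeOne

variable {V : Type*} [AddCommGroup V] [Module ℝ V]

/-- The exterior product of a linear form with an alternating form, as a linear map in the linear
form. -/
def wedgeLinearForm {k : ℕ} (β : V [⋀^Fin k]→ₗ[ℝ] ℝ) :
    Module.Dual ℝ V →ₗ[ℝ] V [⋀^Fin (k + 1)]→ₗ[ℝ] ℝ :=
  AlternatingMap.alternatizeUncurryFinLM ∘ₗ LinearMap.smulRightₗ.flip β

theorem wedgeLinearForm_apply {k : ℕ} (β : V [⋀^Fin k]→ₗ[ℝ] ℝ) (l : Module.Dual ℝ V)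
    (v : Fin (k + 1) → V) :
    wedgeLinearForm β l v = ∑ i : Fin (k + 1), (-1) ^ (i : ℕ) * (l (v i) * β (i.removeNth v)) := by
  simp [wedgeLinearForm, AlternatingMap.alternatizeUncurryFin_apply]

theorem wedgeLinearForm_compLinearMap {k : ℕ} (β : V [⋀^Fin k]→ₗ[ℝ] ℝ) (l : Module.Dual ℝ V)
    (A : V →ₗ[ℝ] V) :
    wedgeLinearForm (β.compLinearMap A) (l ∘ₗ A) = (wedgeLinearForm β l).compLinearMap A := by
  ext v
  simp only [wedgeLinearForm_apply, AlternatingMap.compLinearMap_apply, LinearMap.comp_apply]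
  rfl

variable [FiniteDimensional ℝ V]

/-- A nonzero form of degree `dim V - 1` determines a nonzero vector, up to a volume form: every
endomorphism preserving the form multiplies this vector by its determinant. -/
theorem exists_ne_zero_forall_apply_eq_det_smul {k : ℕ} (hV : Module.finrank ℝ V = k + 1)
    (β : V [⋀^Fin k]→ₗ[ℝ] ℝ) (hβ : β ≠ 0) :
    ∃ v : V, v ≠ 0 ∧ ∀ A : V →ₗ[ℝ] V, β.compLinearMap A = β → A v = LinearMap.det A • v := by
  let b := Module.finBasisOfFinrankEq ℝ V hV
  -- By reflexivity this functional is evaluation at a vector v; then l ∧ β = l(v) det for all l,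
  -- that is, β is the contraction of det with v.
  let c : Module.Dual ℝ (Module.Dual ℝ V) :=
    { toFun := fun l => wedgeLinearForm β l b
      map_add' := fun l m => by simp
      map_smul' := fun r l => by simp }
  obtain ⟨v, hv⟩ := (Module.evalEquiv ℝ V).surjective c
  have hc : ∀ l, l v = wedgeLinearForm β l b := fun l => by
    change _ = c l
    rw [← hv]; rfl
  have hdet : ∀ l, wedgeLinearForm β l = l v • b.det := fun l => by
    rw [hc]; exact AlternatingMap.eq_smul_basis_det b _
  refine ⟨v, ?_, fun A hA => ?_⟩
  -- If v = 0, every l ∧ β vanishes. But β is nonzero on some k independent vectors w, and a nonzero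
  -- l killing their span gives (l ∧ β)(u, w) = l(u) β(w) ≠ 0 for a suitable u.
  · rintro rfl
    obtain ⟨w, hw⟩ : ∃ w, β w ≠ 0 := by
      by_contra! H
      exact hβ (AlternatingMap.ext H)
    have hli : LinearIndependent ℝ w := by
      by_contra H
      exact hw (β.map_linearDependent w H)
    have hlt : Submodule.span ℝ (Set.range w) < ⊤ := by
      refine Submodule.lt_top_of_finrank_lt_finrank ?_
      rw [finrank_span_eq_card hli, hV]
      simp
    obtain ⟨l, hl, hwl⟩ := Submodule.exists_le_ker_of_lt_top _ hlt
    obtain ⟨u, hu⟩ : ∃ u, l u ≠ 0 := by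
      by_contra! H
      exact hl (LinearMap.ext H)
    have hlw : ∀ i, l (w i) = 0 := fun i => hwl (Submodule.subset_span ⟨i, rfl⟩)
    have h0 : wedgeLinearForm β l (Fin.cons u w) = 0 := by rw [hdet]; simp
    rw [wedgeLinearForm_apply, Fin.sum_univ_succ] at h0
    simp [hlw, hu, hw] at h0
  · rw [← sub_eq_zero, ← Module.forall_dual_apply_eq_zero_iff ℝ]
    intro l
    -- Since A preserves β, (l ∘ A) ∧ β = A*(l ∧ β); on the basis this reads l(A v) = det(A) l(v).
    have h1 : wedgeLinearForm β (l ∘ₗ A) = (wedgeLinearForm β l).compLinearMap A := by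
      conv_lhs => rw [← hA]
      exact wedgeLinearForm_compLinearMap β l A
    have h2 := congrArg (fun f => f b) h1
    simp only [hdet, AlternatingMap.smul_apply, AlternatingMap.compLinearMap_apply] at h2
    have h3 : b.det (fun i => A (b i)) = LinearMap.det A := by
      have := b.det_comp A b
      rwa [b.det_self, mul_one] at this
    rw [h3, b.det_self] at h2
    simp only [LinearMap.comp_apply, smul_eq_mul, mul_one] at h2
    simp [h2, mul_comm]

/-- If a nonzero form of degree `dim V - 1` is preserved by a family of isometries of a definite
symmetric form in which every member is a square, then the family has a common nonzero fixed
vector. -/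
theorem exists_ne_zero_forall_apply_eq {k : ℕ} (hV : Module.finrank ℝ V = k + 1)
    (β : V [⋀^Fin k]→ₗ[ℝ] ℝ) (hβ : β ≠ 0) (g : V → V → ℝ)
    (hsmul : ∀ (r : ℝ) (v : V), g (r • v) (r • v) = r ^ 2 * g v v)
    (hpos : ∀ v, v ≠ 0 → 0 < g v v) {ι : Type*} (A : ι → V →ₗ[ℝ] V)
    (hA : ∀ i v, g (A i v) (A i v) = g v v) (hAβ : ∀ i, β.compLinearMap (A i) = β)
    (hsq : ∀ i, ∃ j, A i = A j ∘ₗ A j) :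
    ∃ v : V, v ≠ 0 ∧ ∀ i, A i v = v := by
  obtain ⟨v, hv, h⟩ := exists_ne_zero_forall_apply_eq_det_smul hV β hβ
  refine ⟨v, hv, fun i => ?_⟩
  obtain ⟨j, hj⟩ := hsq i
  have h1 := hA j v
  -- The square root A_j scales v by its determinant and preserves its norm, so det(A_j)² = 1, which
  -- is det(A_i).
  rw [h _ (hAβ j), hsmul] at h1
  have h2 : LinearMap.det (A j) ^ 2 = 1 :=
    mul_right_cancel₀ (hpos v hv).ne' (h1.trans (one_mul _).symm)
  rw [h _ (hAβ i), hj, LinearMap.det_comp, ← sq, h2, one_smul]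

end CodegreeOne

/-! ### Naturality of the exterior product -/

section Pullback

variable {V W : Type*} [AddCommGroup V] [Module ℝ V] [TopologicalSpace V]
  [AddCommGroup W] [Module ℝ W] [TopologicalSpace W]

theorem wedge_apply {p q : ℕ} (a : V [⋀^Fin p]→L[ℝ] ℝ) (b : V [⋀^Fin q]→L[ℝ] ℝ)
    (v : Fin (p + q) → V) :
    wedge a b v = LinearMap.mul' ℝ ℝ ((a.toAlternatingMap.domCoprod b.toAlternatingMap)
      (fun i => v (finSumFinEquiv i))) :=
  rfl

theorem wedge_compContinuousLinearMap {p q : ℕ} (a : V [⋀^Fin p]→L[ℝ] ℝ)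
    (b : V [⋀^Fin q]→L[ℝ] ℝ) (A : W →L[ℝ] V) :
    (wedge a b).compContinuousLinearMap A =
      wedge (a.compContinuousLinearMap A) (b.compContinuousLinearMap A) := by
  ext v
  change wedge a b (fun i => A (v i)) = _
  simp only [wedge_apply, AlternatingMap.domCoprod_apply, sum_apply, map_sum]
  refine Finset.sum_congr rfl fun σ _ => ?_
  induction σ using Quotient.inductionOn' with | _ σ
  rfl

theorem wedgePow_compContinuousLinearMap (w : V [⋀^Fin 2]→L[ℝ] ℝ) (A : W →L[ℝ] V) (k : ℕ) :
    (wedgePow w k).compContinuousLinearMap A = wedgePow (w.compContinuousLinearMap A) k := by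
  induction k with
  | zero => rfl
  | succ k ih =>
    change (wedge _ _).compContinuousLinearMap A = wedge _ _
    rw [wedge_compContinuousLinearMap, ih]

end Pullback

/-! ### Naturality of the exterior derivative -/

section ExtDeriv

variable {E F : Type*} [NormedAddCommGroup E] [NormedSpace ℝ E]
  [NormedAddCommGroup F] [NormedSpace ℝ F]

theorem differentiableAt_pullback {k : ℕ} {w : F → F [⋀^Fin k]→L[ℝ] ℝ} {f : E → F} {x : E}
    (hw : DifferentiableAt ℝ w (f x)) (hf : ContDiffAt ℝ 2 f x) :
    DifferentiableAt ℝ (fun x => (w (f x)).compContinuousLinearMap (fderiv ℝ f x)) x := by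
  have h1 : DifferentiableAt ℝ f x := hf.differentiableAt (by simp)
  have h2 : DifferentiableAt ℝ (fderiv ℝ f) x :=
    (hf.fderiv_right (m := 1) (by norm_num)).differentiableAt (by simp)
  exact (hw.comp x h1).continuousAlternatingMapCompContinuousLinearMap h2

/-- The exterior derivative commutes with the pullback by a local diffeomorphism, whether or not
the form is differentiable. -/
theorem extDeriv_pullback_of_leftInverse {k : ℕ} {w : F → F [⋀^Fin k]→L[ℝ] ℝ} {f : E → F}
    {g : F → E} {x : E} (hf : ContDiffAt ℝ 2 f x) (hg : ContDiffAt ℝ 2 g (f x)) (hgx : g (f x) = x)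
    (hfg : ∀ᶠ y in 𝓝 (f x), f (g y) = y) :
    extDeriv (fun x => (w (f x)).compContinuousLinearMap (fderiv ℝ f x)) x =
      (extDeriv w (f x)).compContinuousLinearMap (fderiv ℝ f x) := by
  by_cases hw : DifferentiableAt ℝ w (f x)
  · exact extDeriv_pullback hw hf (by simp)
  -- Pulling back by the local inverse would make `w` differentiable, so here neither form is and
  -- both exterior derivatives are the default value 0. Invariance of `extDer` thus needs no
  -- regularity of the form.
  · have h : ¬ DifferentiableAt ℝ
        (fun x => (w (f x)).compContinuousLinearMap (fderiv ℝ f x)) x := by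
      intro H
      refine hw (DifferentiableAt.congr_of_eventuallyEq
        (differentiableAt_pullback (f := g) (by rwa [hgx]) hg) ?_)
      have hg1 : ∀ᶠ y in 𝓝 (f x), DifferentiableAt ℝ g y :=
        (hg.eventually (by simp)).mono fun y hy => hy.differentiableAt (by simp)
      have hf1 : ∀ᶠ y in 𝓝 (f x), DifferentiableAt ℝ f (g y) := by
        have hgt : Tendsto g (𝓝 (f x)) (𝓝 x) := by
          simpa only [hgx] using hg.continuousAt.tendsto
        exact hgt.eventually
          ((hf.eventually (by simp)).mono fun y hy => hy.differentiableAt (by simp))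
      filter_upwards [hg1, hf1, hfg.eventually_nhds] with y h1 h2 h3
      have h4 : fderiv ℝ f (g y) ∘L fderiv ℝ g y = ContinuousLinearMap.id ℝ F := by
        rw [← fderiv_comp y h2 h1, ← fderiv_id (x := y)]
        exact EventuallyEq.fderiv_eq h3
      ext v
      change w y v = w (f (g y)) (fun i => (fderiv ℝ f (g y) ∘L fderiv ℝ g y) (v i))
      rw [h4, h3.self_of_nhds]
      rfl
    rw [extDeriv, fderiv_zero_of_not_differentiableAt h, extDeriv,
      fderiv_zero_of_not_differentiableAt hw]
    ext v
    simp [ContinuousAlternatingMap.alternatizeUncurryFin_apply]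

end ExtDeriv

section ManifoldPullback

variable {E : Type*} [NormedAddCommGroup E] [NormedSpace ℝ E]
  {M : Type*} [TopologicalSpace M] [ChartedSpace E M] [IsManifold 𝓘(ℝ, E) ∞ M]

/-- If a form is preserved by a diffeomorphism, then so is its exterior derivative. -/
theorem extDer_invariant {k : ℕ} (α : DiffForm E M k) {f g : M → M}
    (hf : ContMDiff 𝓘(ℝ, E) 𝓘(ℝ, E) ∞ f) (hg : ContMDiff 𝓘(ℝ, E) 𝓘(ℝ, E) ∞ g)
    (hgf : ∀ x, g (f x) = x) (hfg : ∀ x, f (g x) = x)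
    (hα : ∀ x, (α (f x)).compContinuousLinearMap (mfderiv 𝓘(ℝ, E) 𝓘(ℝ, E) f x) = α x) (x : M) :
    (extDer α (f x)).compContinuousLinearMap (mfderiv 𝓘(ℝ, E) 𝓘(ℝ, E) f x) = extDer α x := by
  set φ := extChartAt 𝓘(ℝ, E) x with hφ
  set ψ := extChartAt 𝓘(ℝ, E) (f x) with hψ
  have hφs : ∀ y ∈ φ.target, ContMDiffAt 𝓘(ℝ, E) 𝓘(ℝ, E) ∞ φ.symm y := fun y hy =>
    (contMDiffOn_extChartAt_symm x).contMDiffAt ((isOpen_extChartAt_target x).mem_nhds hy)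
  have hψs : ∀ y ∈ ψ.target, ContMDiffAt 𝓘(ℝ, E) 𝓘(ℝ, E) ∞ ψ.symm y := fun y hy =>
    (contMDiffOn_extChartAt_symm (f x)).contMDiffAt ((isOpen_extChartAt_target (f x)).mem_nhds hy)
  have hφ' : ∀ y ∈ φ.source, ContMDiffAt 𝓘(ℝ, E) 𝓘(ℝ, E) ∞ φ y := fun y hy =>
    (contMDiffOn_extChartAt (x := x)).contMDiffAt
      ((chartAt E x).open_source.mem_nhds (by simpa [hφ] using hy))
  have hψ' : ∀ y ∈ ψ.source, ContMDiffAt 𝓘(ℝ, E) 𝓘(ℝ, E) ∞ ψ y := fun y hy =>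
    (contMDiffOn_extChartAt (x := f x)).contMDiffAt
      ((chartAt E (f x)).open_source.mem_nhds (by simpa [hψ] using hy))
  have hx : x ∈ φ.source := mem_extChartAt_source x
  have hfx : f x ∈ ψ.source := mem_extChartAt_source (f x)
  have hxt : φ x ∈ φ.target := φ.map_source hx
  have hfxt : ψ (f x) ∈ ψ.target := ψ.map_source hfx
  have hφx : φ.symm (φ x) = x := φ.left_inv hx
  have hψx : ψ.symm (ψ (f x)) = f x := ψ.left_inv hfx
  -- τ is `f` read in the preferred charts at `x` and `f x`, and τ' is its local inverse.
  set τ : E → E := fun y => ψ (f (φ.symm y)) with hτ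
  set τ' : E → E := fun y => φ (g (ψ.symm y)) with hτ'
  have hτx : τ (φ x) = ψ (f x) := by simp only [hτ, hφx]
  have hτ'x : τ' (ψ (f x)) = φ x := by simp only [hτ', hψx, hgf]
  have hτs : ∀ y ∈ φ.target, f (φ.symm y) ∈ ψ.source →
      ContMDiffAt 𝓘(ℝ, E) 𝓘(ℝ, E) ∞ τ y := fun y hy hy' =>
    (hψ' _ hy').comp y (hf.contMDiffAt.comp y (hφs y hy))
  have hτs' : ContMDiffAt 𝓘(ℝ, E) 𝓘(ℝ, E) ∞ τ' (ψ (f x)) := by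
    refine ContMDiffAt.comp _ (hφ' _ ?_) (hg.contMDiffAt.comp _ (hψs _ hfxt))
    simpa only [Function.comp_apply, hψx, hgf] using hx
  -- points near `φ x`
  have hev : ∀ᶠ y in 𝓝 (φ x), y ∈ φ.target ∧ f (φ.symm y) ∈ ψ.source := by
    refine Filter.Eventually.and ((isOpen_extChartAt_target x).mem_nhds hxt) ?_
    have hc : ContinuousAt (fun y => f (φ.symm y)) (φ x) :=
      hf.continuous.continuousAt.comp (hφs _ hxt).continuousAt
    refine hc.eventually ((isOpen_extChartAt_source (I := 𝓘(ℝ, E)) (f x)).mem_nhds ?_)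
    simpa only [hφx] using hfx
  have hev' : ∀ᶠ y in 𝓝 (ψ (f x)), y ∈ ψ.target ∧ g (ψ.symm y) ∈ φ.source := by
    refine Filter.Eventually.and ((isOpen_extChartAt_target (f x)).mem_nhds hfxt) ?_
    have hc : ContinuousAt (fun y => g (ψ.symm y)) (ψ (f x)) :=
      hg.continuous.continuousAt.comp (hψs _ hfxt).continuousAt
    refine hc.eventually ((isOpen_extChartAt_source (I := 𝓘(ℝ, E)) x).mem_nhds ?_)
    simpa only [hψx, hgf] using hx
  -- Invariance of α in charts: near φ(x), its expression at `x` is the τ-pullback of its expression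
  -- at `f x`.
  have hloc : chartForm α x =ᶠ[𝓝 (φ x)]
      fun y => (chartForm α (f x) (τ y)).compContinuousLinearMap (fderiv ℝ τ y) := by
    filter_upwards [hev.eventually_nhds] with y hy
    obtain ⟨hy1, hy2⟩ := hy.self_of_nhds
    have hψτ : ψ.symm (τ y) = f (φ.symm y) := ψ.left_inv hy2
    have hd1 : mfderiv 𝓘(ℝ, E) 𝓘(ℝ, E) (fun y => ψ.symm (τ y)) y =
        (mfderiv 𝓘(ℝ, E) 𝓘(ℝ, E) ψ.symm (τ y)) ∘L (mfderiv 𝓘(ℝ, E) 𝓘(ℝ, E) τ y) :=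
      mfderiv_comp y ((hψs _ (ψ.map_source hy2)).mdifferentiableAt (by simp))
        ((hτs y hy1 hy2).mdifferentiableAt (by simp))
    have hd2 : mfderiv 𝓘(ℝ, E) 𝓘(ℝ, E) (fun y => f (φ.symm y)) y =
        (mfderiv 𝓘(ℝ, E) 𝓘(ℝ, E) f (φ.symm y)) ∘L (mfderiv 𝓘(ℝ, E) 𝓘(ℝ, E) φ.symm y) :=
      mfderiv_comp y (hf.mdifferentiableAt (by simp)) ((hφs y hy1).mdifferentiableAt (by simp))
    have hd3 : (mfderiv 𝓘(ℝ, E) 𝓘(ℝ, E) (fun y => ψ.symm (τ y)) y : E →L[ℝ] E) =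
        mfderiv 𝓘(ℝ, E) 𝓘(ℝ, E) (fun y => f (φ.symm y)) y :=
      EventuallyEq.mfderiv_eq (hy.mono fun z hz => ψ.left_inv hz.2)
    rw [← mfderiv_eq_fderiv]
    ext v
    have e1 : chartForm α x y v = α (f (φ.symm y)) (fun i =>
        mfderiv 𝓘(ℝ, E) 𝓘(ℝ, E) (fun y => f (φ.symm y)) y (v i)) := by
      rw [hd2]
      change α (φ.symm y) _ = _
      rw [← hα]
      rfl
    have e2 : (chartForm α (f x) (τ y)).compContinuousLinearMap
        (mfderiv 𝓘(ℝ, E) 𝓘(ℝ, E) τ y) v = (α (ψ.symm (τ y)) : E [⋀^Fin k]→L[ℝ] ℝ) (fun i =>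
        (mfderiv 𝓘(ℝ, E) 𝓘(ℝ, E) (fun y => ψ.symm (τ y)) y : E →L[ℝ] E) (v i)) := by
      rw [hd1]
      rfl
    rw [e1]
    refine Eq.trans ?_ e2.symm
    rw [hd3, hψτ]
  have hpb : extDeriv (chartForm α x) (φ x) =
      (extDeriv (chartForm α (f x)) (ψ (f x))).compContinuousLinearMap (fderiv ℝ τ (φ x)) := by
    rw [hloc.extDeriv_eq, ← hτx]
    refine extDeriv_pullback_of_leftInverse (g := τ') ?_ ?_ ?_ ?_
    · exact (contMDiffAt_iff_contDiffAt.1 (hτs _ hxt (by rwa [hφx]))).of_le (by norm_cast)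
    · rw [hτx]
      exact (contMDiffAt_iff_contDiffAt.1 hτs').of_le (by norm_cast)
    · rw [hτx, hτ'x]
    · rw [hτx]
      filter_upwards [hev'] with y hy
      simp only [hτ, hτ', φ.left_inv hy.2, hfg, ψ.right_inv hy.1]
  have hd1 : mfderiv 𝓘(ℝ, E) 𝓘(ℝ, E) (fun y => ψ (f y)) x =
      (mfderiv 𝓘(ℝ, E) 𝓘(ℝ, E) ψ (f x)) ∘L (mfderiv 𝓘(ℝ, E) 𝓘(ℝ, E) f x) :=
    mfderiv_comp x ((hψ' _ hfx).mdifferentiableAt (by simp)) (hf.mdifferentiableAt (by simp))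
  have hd2 : mfderiv 𝓘(ℝ, E) 𝓘(ℝ, E) (fun y => τ (φ y)) x =
      (mfderiv 𝓘(ℝ, E) 𝓘(ℝ, E) τ (φ x)) ∘L (mfderiv 𝓘(ℝ, E) 𝓘(ℝ, E) φ x) :=
    mfderiv_comp x ((hτs _ hxt (by rwa [hφx])).mdifferentiableAt (by simp))
      ((hφ' _ hx).mdifferentiableAt (by simp))
  -- Both sides are now the same form on the model space, pulled back by the differentials of ψ ∘ f
  -- and τ ∘ φ, which agree near `x`.
  have hd3 : (mfderiv 𝓘(ℝ, E) 𝓘(ℝ, E) (fun y => ψ (f y)) x : E →L[ℝ] E) =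
      mfderiv 𝓘(ℝ, E) 𝓘(ℝ, E) (fun y => τ (φ y)) x := by
    refine EventuallyEq.mfderiv_eq ?_
    filter_upwards [(isOpen_extChartAt_source (I := 𝓘(ℝ, E)) x).mem_nhds hx] with y hy
    simp only [hτ, φ.left_inv hy]
  have e1 : (extDer α (f x)).compContinuousLinearMap (mfderiv 𝓘(ℝ, E) 𝓘(ℝ, E) f x) =
      (extDeriv (chartForm α (f x)) (ψ (f x))).compContinuousLinearMap
        (mfderiv 𝓘(ℝ, E) 𝓘(ℝ, E) (fun y => ψ (f y)) x) := by
    rw [hd1]; rfl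
  have e2 : extDer α x = (extDeriv (chartForm α (f x)) (ψ (f x))).compContinuousLinearMap
        (mfderiv 𝓘(ℝ, E) 𝓘(ℝ, E) (fun y => τ (φ y)) x) := by
    rw [hd2, mfderiv_eq_fderiv]
    change (extDeriv (chartForm α x) (φ x)).compContinuousLinearMap _ = _
    rw [hpb]
    rfl
  rw [e1, e2]
  exact congrArg _ hd3

end ManifoldPullback

/-! ### Local sections of submersions -/

section Submersion

variable {E E' : Type*} [NormedAddCommGroup E] [NormedSpace ℝ E]
  [NormedAddCommGroup E'] [NormedSpace ℝ E']
  {M N : Type*} [TopologicalSpace M] [ChartedSpace E M]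
  [TopologicalSpace N] [ChartedSpace E' N]

/-- A submersion has a smooth local section through every point. -/
theorem exists_local_section {f : M → N}
    (hf : Manifold.IsSubmersion 𝓘(ℝ, E) 𝓘(ℝ, E') ∞ f) (x : M) :
    ∃ s : N → M, ContMDiffAt 𝓘(ℝ, E') 𝓘(ℝ, E) ∞ s (f x) ∧ s (f x) = x ∧
      ∀ᶠ y in 𝓝 (f x), f (s y) = y := by
  have h := hf.isSubmersionAt x
  set e := h.domChart
  set c := h.codChart
  set L := h.equiv
  have hxe : x ∈ e.source := h.mem_domChart_source
  have hxc : f x ∈ c.source := h.mem_codChart_source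
  have hw : ∀ y ∈ e.target, c (f (e.symm y)) = (L y).1 := fun y hy => by
    have hy' : y ∈ (e.extend 𝓘(ℝ, E)).target := by simpa using hy
    simpa using h.writtenInCharts hy'
  -- Freezing the fibre coordinate at its value at `x` makes the section pass through `x`.
  let σ : N → E := fun y => L.symm (c y, (L (e x)).2)
  have hσx : σ (f x) = e x := by
    have h1 := hw (e x) (e.map_source hxe)
    rw [e.left_inv hxe] at h1
    simp only [σ, h1, Prod.mk.eta, ContinuousLinearEquiv.symm_apply_apply]
  have hσ : ContMDiffAt 𝓘(ℝ, E') 𝓘(ℝ, E) ∞ σ (f x) := by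
    have h1 : ContMDiffAt 𝓘(ℝ, E') 𝓘(ℝ, E') ∞ c (f x) :=
      contMDiffAt_of_mem_maximalAtlas h.codChart_mem_maximalAtlas hxc
    have h2 : ContDiff ℝ ∞ (fun u : E' => L.symm (u, (L (e x)).2)) := by fun_prop
    exact h2.contMDiff.contMDiffAt.comp (f x) h1
  have hnear : ∀ᶠ y in 𝓝 (f x), y ∈ c.source ∧ σ y ∈ e.target := by
    refine Filter.Eventually.and (c.open_source.mem_nhds hxc)
      (hσ.continuousAt.eventually (e.open_target.mem_nhds ?_))
    rw [hσx]
    exact e.map_source hxe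
  refine ⟨fun y => e.symm (σ y), ?_, ?_, ?_⟩
  · refine ContMDiffAt.comp (f x) ?_ hσ
    exact contMDiffAt_symm_of_mem_maximalAtlas h.domChart_mem_maximalAtlas
      (by rw [hσx]; exact e.map_source hxe)
  · change e.symm (σ (f x)) = x
    rw [hσx, e.left_inv hxe]
  · filter_upwards [hnear] with y hy
    refine c.injOn ?_ hy.1 ?_
    · exact h.source_subset_preimage_source (e.map_target hy.2)
    · rw [hw _ hy.2]
      simp [σ]

/-- The differential of a local section is a right inverse. -/
theorem mfderiv_surjective_of_isSubmersion {f : M → N}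
    (hf : Manifold.IsSubmersion 𝓘(ℝ, E) 𝓘(ℝ, E') ∞ f) (hfs : ContMDiff 𝓘(ℝ, E) 𝓘(ℝ, E') ∞ f)
    (x : M) (v : TangentSpace 𝓘(ℝ, E') (f x)) :
    ∃ u : TangentSpace 𝓘(ℝ, E) x, mfderiv 𝓘(ℝ, E) 𝓘(ℝ, E') f x u = v := by
  obtain ⟨s, hs, hsx, hfs'⟩ := exists_local_section hf x
  refine ⟨(mfderiv 𝓘(ℝ, E') 𝓘(ℝ, E) s (f x) v : E), ?_⟩
  have h1 : mfderiv 𝓘(ℝ, E') 𝓘(ℝ, E') (f ∘ s) (f x) = _ :=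
    mfderiv_comp_of_eq (I' := 𝓘(ℝ, E)) (y := x) (hfs.mdifferentiableAt (by simp))
      (hs.mdifferentiableAt (by simp)) hsx
  have h2 : (mfderiv 𝓘(ℝ, E') 𝓘(ℝ, E') (f ∘ s) (f x) : E' →L[ℝ] E') =
      mfderiv 𝓘(ℝ, E') 𝓘(ℝ, E') id (f x) := EventuallyEq.mfderiv_eq hfs'
  rw [mfderiv_id] at h2
  have h3 : (mfderiv 𝓘(ℝ, E') 𝓘(ℝ, E') (f ∘ s) (f x) : E' →L[ℝ] E') v = v := by
    rw [h2]; rfl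
  have h4 : (mfderiv 𝓘(ℝ, E) 𝓘(ℝ, E') f (s (f x)) : E →L[ℝ] E') =
      mfderiv 𝓘(ℝ, E) 𝓘(ℝ, E') f x := by rw [hsx]
  rw [h1] at h3
  change (mfderiv 𝓘(ℝ, E) 𝓘(ℝ, E') f (s (f x)) : E →L[ℝ] E')
    ((mfderiv 𝓘(ℝ, E') 𝓘(ℝ, E) s (f x) : E' →L[ℝ] E) v) = v at h3
  rw [h4] at h3
  exact h3

/-- Smoothness of a map can be tested after composition with a surjective submersion. -/
theorem contMDiff_of_comp_submersion {E'' : Type*} [NormedAddCommGroup E''] [NormedSpace ℝ E'']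
    {P : Type*} [TopologicalSpace P] [ChartedSpace E'' P] {f : M → N}
    (hf : Manifold.IsSubmersion 𝓘(ℝ, E) 𝓘(ℝ, E') ∞ f) (hsurj : Function.Surjective f)
    {g : N → P} (hg : ContMDiff 𝓘(ℝ, E) 𝓘(ℝ, E'') ∞ (g ∘ f)) :
    ContMDiff 𝓘(ℝ, E') 𝓘(ℝ, E'') ∞ g := by
  intro y
  obtain ⟨x, rfl⟩ := hsurj y
  obtain ⟨s, hs, hsx, hfs⟩ := exists_local_section hf x
  refine (ContMDiffAt.comp (f x) (hg.contMDiffAt (x := s (f x))) hs).congr_of_eventuallyEq ?_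
  filter_upwards [hfs] with z hz
  simp only [Function.comp_apply, hz]

end Submersion

/-! ### The adjoint action, its fixed vectors, and averaging -/

section LieGroupAdjoint

variable {E : Type*} [NormedAddCommGroup E] [NormedSpace ℝ E]
  {K : Type*} [TopologicalSpace K] [ChartedSpace E K] [Group K]

variable (E) in
/-- The adjoint action of an element of a Lie group on the tangent space at the identity, the
tangent spaces at `1` and at `z * 1 * z⁻¹` being identified with the model space. -/
def adjoint (z : K) : E →L[ℝ] E :=
  mfderiv 𝓘(ℝ, E) 𝓘(ℝ, E) (fun k : K => z * k * z⁻¹) 1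

variable [LieGroup 𝓘(ℝ, E) ∞ K]

theorem contMDiff_conj (z : K) :
    ContMDiff 𝓘(ℝ, E) 𝓘(ℝ, E) ∞ (fun k : K => z * k * z⁻¹) :=
  (contMDiff_const.mul contMDiff_id).mul contMDiff_const

theorem adjoint_mul (z w : K) : adjoint E (z * w) = adjoint E z ∘L adjoint E w := by
  have h : (fun k : K => z * w * k * (z * w)⁻¹) =
      (fun k : K => z * k * z⁻¹) ∘ (fun k : K => w * k * w⁻¹) := by
    ext k; simp [mul_assoc]
  have h1 := mfderiv_comp (I := 𝓘(ℝ, E)) (I' := 𝓘(ℝ, E)) (I'' := 𝓘(ℝ, E)) (1 : K)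
    (g := fun k : K => z * k * z⁻¹) (f := fun k : K => w * k * w⁻¹)
    ((contMDiff_conj z).mdifferentiableAt (by simp))
    ((contMDiff_conj w).mdifferentiableAt (by simp))
  have h2 : (mfderiv 𝓘(ℝ, E) 𝓘(ℝ, E) (fun k : K => z * k * z⁻¹) (w * 1 * w⁻¹) : E →L[ℝ] E) =
      adjoint E z := by
    rw [adjoint, show w * 1 * w⁻¹ = (1 : K) by simp]
  rw [adjoint, h]
  refine Eq.trans h1 ?_
  change (mfderiv 𝓘(ℝ, E) 𝓘(ℝ, E) (fun k : K => z * k * z⁻¹) (w * 1 * w⁻¹) : E →L[ℝ] E) ∘L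
    adjoint E w = _
  rw [h2]
  rfl

theorem continuous_adjoint : Continuous (fun z : K => adjoint E z) := by
  rw [continuous_iff_continuousAt]
  intro z₀
  have hf : ContMDiffAt (𝓘(ℝ, E).prod 𝓘(ℝ, E)) 𝓘(ℝ, E) ∞
      (Function.uncurry fun (z k : K) => z * k * z⁻¹) (z₀, 1) :=
    ((contMDiffAt_fst.mul contMDiffAt_snd).mul contMDiffAt_fst.inv)
  have h := (ContMDiffAt.mfderiv (m := 0) (n := ∞) (fun (z k : K) => z * k * z⁻¹)
    (fun _ => (1 : K)) hf contMDiffAt_const (by simp)).continuousAt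
  refine h.congr (Eventually.of_forall fun z => ?_)
  -- Smoothness of the differential is stated in tangent coordinates. All base points equal 1, some
  -- only propositionally, so the coordinate changes are identities.
  have hid : ∀ a b c : K, a = 1 → b = 1 → c = 1 → ∀ v : E,
      (tangentBundleCore 𝓘(ℝ, E) K).coordChange (achart E a) (achart E b) c v = v := by
    rintro a b c rfl rfl rfl v
    exact (tangentBundleCore 𝓘(ℝ, E) K).coordChange_self (achart E 1) 1 (by simp) v
  refine (inTangentCoordinates_eq (I := 𝓘(ℝ, E)) (I' := 𝓘(ℝ, E)) (fun _ : K => (1 : K))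
    (fun z : K => z * 1 * z⁻¹) (fun z : K => adjoint E z) (x₀ := z₀) (x := z)
    (mem_chart_source E (1 : K)) ?_).trans ?_
  · simp
  · ext v
    change (tangentBundleCore 𝓘(ℝ, E) K).coordChange (achart E (z * 1 * z⁻¹))
      (achart E (z₀ * 1 * z₀⁻¹)) (z * 1 * z⁻¹) (adjoint E z
        ((tangentBundleCore 𝓘(ℝ, E) K).coordChange (achart E 1) (achart E 1) 1 v)) = _
    rw [hid _ _ _ rfl rfl rfl, hid _ _ _ (by simp) (by simp) (by simp)]

variable [FiniteDimensional ℝ E] [T2Space K]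

/-- A tangent vector at `1` fixed by the adjoint action of a subgroup is the velocity of a curve
commuting with the subgroup. -/
theorem exists_curve_commute_of_adjoint_eq (Z : Set K) (X : E)
    (hX : ∀ z ∈ Z, adjoint E z X = X) :
    ∃ γ : ℝ → K, γ 0 = 1 ∧
      HasMFDerivAt 𝓘(ℝ, ℝ) 𝓘(ℝ, E) γ 0 ((1 : ℝ →L[ℝ] ℝ).smulRight X : ℝ →L[ℝ] E) ∧
      ∀ᶠ t in 𝓝 (0 : ℝ), ∀ z ∈ Z, z * γ t = γ t * z := by
  have : LieGroup 𝓘(ℝ, E) (minSmoothness ℝ 3) K := LieGroup.of_le (n := ∞)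
    (by rw [minSmoothness_of_isRCLikeNormedField]; exact ENat.LEInfty.out)
  have : CompleteSpace E := FiniteDimensional.complete ℝ E
  have : IsManifold 𝓘(ℝ, E) 1 K := IsManifold.of_le (n := ∞) (by norm_cast)
  let V : (k : K) → TangentSpace 𝓘(ℝ, E) k := mulInvariantVectorField (I := 𝓘(ℝ, E)) (G := K) X
  have hV : ContMDiff 𝓘(ℝ, E) 𝓘(ℝ, E).tangent 1
      (fun k => (⟨k, V k⟩ : TangentBundle 𝓘(ℝ, E) K)) :=
    (contMDiff_mulInvariantVectorField (I := 𝓘(ℝ, E)) (G := K) X).of_le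
      (by rw [minSmoothness_of_isRCLikeNormedField]; norm_num)
  obtain ⟨γ, hγ0, hγ⟩ := exists_isMIntegralCurveAt_of_contMDiffAt_boundaryless 0
    (hV.contMDiffAt (x := (1 : K)))
  have hV1 : (V 1 : E) = X := by
    change (mfderiv 𝓘(ℝ, E) 𝓘(ℝ, E) (fun k : K => 1 * k) 1 : E →L[ℝ] E) X = X
    rw [show (fun k : K => 1 * k) = id from funext one_mul, mfderiv_id]
    rfl
  -- Conjugation by z after left translation by k is left translation by z k z⁻¹ after conjugation;
  -- differentiating at 1 and using Ad(z) X = X shows that conjugation preserves `V`.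
  have hconj : ∀ z ∈ Z, ∀ k : K,
      (mfderiv 𝓘(ℝ, E) 𝓘(ℝ, E) (fun k : K => z * k * z⁻¹) k : E →L[ℝ] E) (V k) =
        V (z * k * z⁻¹) := by
    intro z hz k
    have hL : ∀ a : K, ContMDiff 𝓘(ℝ, E) 𝓘(ℝ, E) ∞ (fun b : K => a * b) :=
      fun a => contMDiff_const.mul contMDiff_id
    have h1 := mfderiv_comp (I := 𝓘(ℝ, E)) (I' := 𝓘(ℝ, E)) (I'' := 𝓘(ℝ, E)) (1 : K)
      (g := fun b : K => z * b * z⁻¹) (f := fun b : K => k * b)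
      ((contMDiff_conj z).mdifferentiableAt (by simp)) ((hL k).mdifferentiableAt (by simp))
    have h2 := mfderiv_comp (I := 𝓘(ℝ, E)) (I' := 𝓘(ℝ, E)) (I'' := 𝓘(ℝ, E)) (1 : K)
      (g := fun b : K => (z * k * z⁻¹) * b) (f := fun b : K => z * b * z⁻¹)
      ((hL _).mdifferentiableAt (by simp)) ((contMDiff_conj z).mdifferentiableAt (by simp))
    have h3 : (fun b : K => z * b * z⁻¹) ∘ (fun b : K => k * b) =
        (fun b : K => (z * k * z⁻¹) * b) ∘ (fun b : K => z * b * z⁻¹) := by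
      ext b; simp [mul_assoc]
    have h4 : (mfderiv 𝓘(ℝ, E) 𝓘(ℝ, E) (fun b : K => z * b * z⁻¹) (k * 1) : E →L[ℝ] E) =
        mfderiv 𝓘(ℝ, E) 𝓘(ℝ, E) (fun b : K => z * b * z⁻¹) k := by rw [mul_one]
    have h5 : (mfderiv 𝓘(ℝ, E) 𝓘(ℝ, E) (fun b : K => (z * k * z⁻¹) * b) (z * 1 * z⁻¹) :
        E →L[ℝ] E) = mfderiv 𝓘(ℝ, E) 𝓘(ℝ, E) (fun b : K => (z * k * z⁻¹) * b) 1 := by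
      rw [show z * 1 * z⁻¹ = (1 : K) by simp]
    have h6 : ((mfderiv 𝓘(ℝ, E) 𝓘(ℝ, E) (fun b : K => z * b * z⁻¹) (k * 1) : E →L[ℝ] E) ∘L
        (mfderiv 𝓘(ℝ, E) 𝓘(ℝ, E) (fun b : K => k * b) 1 : E →L[ℝ] E)) =
        (mfderiv 𝓘(ℝ, E) 𝓘(ℝ, E) (fun b : K => (z * k * z⁻¹) * b) (z * 1 * z⁻¹) :
          E →L[ℝ] E) ∘L adjoint E z := by
      refine h1.symm.trans (Eq.trans ?_ h2)
      rw [h3]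
    rw [h4, h5] at h6
    have h7 := congrArg (fun A : E →L[ℝ] E => A X) h6
    change _ = (mfderiv 𝓘(ℝ, E) 𝓘(ℝ, E) (fun b : K => (z * k * z⁻¹) * b) 1 : E →L[ℝ] E)
      (adjoint E z X) at h7
    rw [hX z hz] at h7
    exact h7
  -- The interval depends only on γ, so it serves all z at once: each conjugate of γ is an integral
  -- curve of `V` on it starting at 1, hence equals γ.
  obtain ⟨ε, hε, hγε⟩ := isMIntegralCurveAt_iff'.1 hγ
  rw [Real.ball_eq_Ioo, zero_sub, zero_add] at hγε
  refine ⟨γ, hγ0, ?_, ?_⟩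
  · have h := hγ.hasMFDerivAt
    have h1 : (V (γ 0) : E) = X := by rw [hγ0, hV1]
    have h2 : HasMFDerivAt 𝓘(ℝ, ℝ) 𝓘(ℝ, E) γ 0
      ((1 : ℝ →L[ℝ] ℝ).smulRight (V (γ 0) : E) : ℝ →L[ℝ] E) := h
    rwa [h1] at h2
  · filter_upwards [Ioo_mem_nhds (neg_lt_zero.2 hε) hε] with t ht z hz
    have hσ : IsMIntegralCurveOn (fun t => z * γ t * z⁻¹) V (Set.Ioo (-ε) ε) := by
      intro s hs
      have h1 := ((contMDiff_conj z).mdifferentiableAt (by simp) :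
        MDifferentiableAt 𝓘(ℝ, E) 𝓘(ℝ, E) (fun k : K => z * k * z⁻¹) (γ s)).hasMFDerivAt
      have h2 := h1.comp_hasMFDerivWithinAt s (hγε s hs)
      have h3 : (mfderiv 𝓘(ℝ, E) 𝓘(ℝ, E) (fun k : K => z * k * z⁻¹) (γ s) : E →L[ℝ] E) ∘L
          ((1 : ℝ →L[ℝ] ℝ).smulRight (V (γ s) : E)) =
          (1 : ℝ →L[ℝ] ℝ).smulRight (V (z * γ s * z⁻¹) : E) := by
        ext
        simp only [ContinuousLinearMap.comp_apply, ContinuousLinearMap.smulRight_apply,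
          one_apply_eq_self, one_smul]
        exact hconj z hz (γ s)
      have h4 : HasMFDerivWithinAt 𝓘(ℝ, ℝ) 𝓘(ℝ, E) (fun t => z * γ t * z⁻¹) (Set.Ioo (-ε) ε) s
        ((mfderiv 𝓘(ℝ, E) 𝓘(ℝ, E) (fun k : K => z * k * z⁻¹) (γ s) : E →L[ℝ] E) ∘L
          ((1 : ℝ →L[ℝ] ℝ).smulRight (V (γ s) : E)) : ℝ →L[ℝ] E) := h2
      have h5 : ∀ L L' : ℝ →L[ℝ] E, L = L' →
          HasMFDerivWithinAt 𝓘(ℝ, ℝ) 𝓘(ℝ, E) (fun t => z * γ t * z⁻¹) (Set.Ioo (-ε) ε) s L →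
          HasMFDerivWithinAt 𝓘(ℝ, ℝ) 𝓘(ℝ, E) (fun t => z * γ t * z⁻¹) (Set.Ioo (-ε) ε) s L' := by
        rintro _ _ rfl h
        exact h
      exact h5 _ _ h3 h4
    have h := isMIntegralCurveOn_Ioo_eqOn_of_contMDiff_boundaryless (t₀ := 0)
      ⟨neg_lt_zero.2 hε, hε⟩ hV hγε hσ (by simp [hγ0]) ht
    simp only at h
    exact (eq_mul_inv_iff_mul_eq.1 h).symm

omit [T2Space K] in
/-- Averaging a tangent vector over a compact subgroup. -/
theorem exists_adjoint_average (Z : Subgroup K) [CompactSpace Z] {F : Type*}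
    [NormedAddCommGroup F] [NormedSpace ℝ F] [FiniteDimensional ℝ F] (D : E →L[ℝ] F) (X : E)
    (hD : ∀ z ∈ Z, D (adjoint E z X) = D X) :
    ∃ Y : E, (∀ z ∈ Z, adjoint E z Y = Y) ∧ D Y = D X := by
  have : IsTopologicalGroup K := topologicalGroup_of_lieGroup 𝓘(ℝ, E) ∞
  have : CompleteSpace E := FiniteDimensional.complete ℝ E
  have : CompleteSpace F := FiniteDimensional.complete ℝ F
  let _ : MeasurableSpace Z := borel Z
  have : BorelSpace Z := ⟨rfl⟩
  -- Normalised on the whole compact group, Haar measure has mass 1, so averaging the constant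
  -- D(Ad(z) X) = D X returns D X.
  let μ : MeasureTheory.Measure Z := MeasureTheory.Measure.haarMeasure ⊤
  have hμ : MeasureTheory.IsProbabilityMeasure μ :=
    ⟨MeasureTheory.Measure.haarMeasure_self (K₀ := (⊤ : TopologicalSpace.PositiveCompacts Z))⟩
  have hcont : Continuous fun z : Z => adjoint E (z : K) X :=
    ((continuous_adjoint (E := E) (K := K)).comp continuous_subtype_val).clm_apply continuous_const
  have hint : MeasureTheory.Integrable (fun z : Z => adjoint E (z : K) X) μ :=
    hcont.integrable_of_hasCompactSupport (HasCompactSupport.of_compactSpace _)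
  refine ⟨∫ z : Z, adjoint E (z : K) X ∂μ, fun z hz => ?_, ?_⟩
  · rw [← ContinuousLinearMap.integral_comp_comm _ hint]
    have h := MeasureTheory.integral_mul_left_eq_self (μ := μ)
      (fun w : Z => adjoint E (w : K) X) ⟨z, hz⟩
    simpa only [Subgroup.coe_mul, adjoint_mul, ContinuousLinearMap.comp_apply] using h
  · rw [← ContinuousLinearMap.integral_comp_comm _ hint]
    have h : (fun z : Z => D (adjoint E (z : K) X)) = fun _ => D X :=
      funext fun z => hD z z.2
    rw [h, MeasureTheory.integral_const]
    simp

end LieGroupAdjoint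

/-! ### Tori -/

section Torus

variable {K : Type*} [TopologicalSpace K] [Group K] {Z : Subgroup K}

theorem IsTorus.compactSpace (hZ : IsTorus Z) : CompactSpace Z := by
  obtain ⟨r, ⟨e⟩⟩ := hZ
  exact e.symm.toHomeomorph.compactSpace

theorem IsTorus.mul_comm (hZ : IsTorus Z) (z w : Z) : z * w = w * z := by
  obtain ⟨r, ⟨e⟩⟩ := hZ
  exact e.injective (by rw [map_mul, map_mul, _root_.mul_comm])

/-- Halve the argument in each circle factor. This is what excludes determinant -1 in the isotropy
action. -/
theorem IsTorus.exists_mul_self (hZ : IsTorus Z) (z : Z) : ∃ w : Z, z = w * w := by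
  obtain ⟨r, ⟨e⟩⟩ := hZ
  have h : ∀ c : Circle, ∃ d : Circle, c = d * d := fun c => by
    refine ⟨Circle.exp (c.1.arg / 2), ?_⟩
    rw [← Circle.exp_add, add_halves, Circle.exp_arg]
  choose d hd using fun i => h (e z i)
  refine ⟨e.symm d, e.injective ?_⟩
  rw [map_mul, e.apply_symm_apply]
  exact funext hd

end Torus

/-! ### The isotropy representation of a homogeneous space -/

section Homogeneous

variable {EK : Type*} [NormedAddCommGroup EK] [NormedSpace ℝ EK]
  {K : Type*} [TopologicalSpace K] [ChartedSpace EK K] [Group K] [LieGroup 𝓘(ℝ, EK) ∞ K]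
  {H : Subgroup K}
  {E : Type*} [NormedAddCommGroup E] [NormedSpace ℝ E]
  [ChartedSpace E (K ⧸ H)]

/-- Composed with the projection, the action of `a` is left translation followed by the projection,
and smoothness descends along a surjective submersion. -/
theorem contMDiff_smul_quotient
    (hF : Manifold.IsSubmersion 𝓘(ℝ, EK) 𝓘(ℝ, E) ∞ (fun a : K => (a : K ⧸ H)))
    (hFs : ContMDiff 𝓘(ℝ, EK) 𝓘(ℝ, E) ∞ (fun a : K => (a : K ⧸ H))) (a : K) :
    ContMDiff 𝓘(ℝ, E) 𝓘(ℝ, E) ∞ (fun y : K ⧸ H => a • y) := by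
  have h1 : ContMDiff 𝓘(ℝ, EK) 𝓘(ℝ, EK) ∞ (fun k : K => a * k) :=
    contMDiff_const.mul contMDiff_id
  exact contMDiff_of_comp_submersion hF Quotient.mk_surjective (hFs.comp h1)

variable (H E) in
/-- The isotropy action at the base point of a homogeneous space, the tangent spaces at `1` and at
`z • 1` being identified with the model space. -/
def isotropy (z : K) : E →L[ℝ] E :=
  mfderiv 𝓘(ℝ, E) 𝓘(ℝ, E) (fun y : K ⧸ H => z • y) ((1 : K) : K ⧸ H)

variable (EK H E) in
/-- The differential at `1` of the projection onto a homogeneous space. -/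
def projDeriv : EK →L[ℝ] E :=
  mfderiv 𝓘(ℝ, EK) 𝓘(ℝ, E) (fun a : K => (a : K ⧸ H)) 1

omit [TopologicalSpace K] in
theorem smul_base {z : K} (hz : z ∈ H) : z • ((1 : K) : K ⧸ H) = ((1 : K) : K ⧸ H) := by
  change ((z * 1 : K) : K ⧸ H) = _
  rw [mul_one, QuotientGroup.eq]
  simpa using hz

theorem isotropy_mul
    (hs : ∀ a : K, ContMDiff 𝓘(ℝ, E) 𝓘(ℝ, E) ∞ (fun y : K ⧸ H => a • y)) (z : K) {w : K}
    (hw : w ∈ H) : isotropy H E (z * w) = isotropy H E z ∘L isotropy H E w := by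
  have h1 := mfderiv_comp (I := 𝓘(ℝ, E)) (I' := 𝓘(ℝ, E)) (I'' := 𝓘(ℝ, E)) ((1 : K) : K ⧸ H)
    (g := fun y : K ⧸ H => z • y) (f := fun y : K ⧸ H => w • y)
    ((hs z).mdifferentiableAt (by simp)) ((hs w).mdifferentiableAt (by simp))
  have h2 : (mfderiv 𝓘(ℝ, E) 𝓘(ℝ, E) (fun y : K ⧸ H => z • y) (w • ((1 : K) : K ⧸ H)) :
      E →L[ℝ] E) = isotropy H E z := by rw [smul_base hw]; rfl
  have h3 : (fun y : K ⧸ H => (z * w) • y) =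
      (fun y : K ⧸ H => z • y) ∘ (fun y : K ⧸ H => w • y) := funext fun y => mul_smul z w y
  rw [isotropy, h3, ← h2]
  exact h1

/-- For z in `H` one has z k H = z k z⁻¹ H, so the projection intertwines conjugation with the
action of z; differentiate at 1. -/
theorem isotropy_comp_projDeriv
    (hFs : ContMDiff 𝓘(ℝ, EK) 𝓘(ℝ, E) ∞ (fun a : K => (a : K ⧸ H)))
    (hs : ∀ a : K, ContMDiff 𝓘(ℝ, E) 𝓘(ℝ, E) ∞ (fun y : K ⧸ H => a • y)) {z : K} (hz : z ∈ H) :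
    isotropy H E z ∘L projDeriv EK H E = projDeriv EK H E ∘L adjoint EK z := by
  have h1 := mfderiv_comp (I := 𝓘(ℝ, EK)) (I' := 𝓘(ℝ, E)) (I'' := 𝓘(ℝ, E)) (1 : K)
    (g := fun y : K ⧸ H => z • y) (f := fun a : K => (a : K ⧸ H))
    ((hs z).mdifferentiableAt (by simp)) (hFs.mdifferentiableAt (by simp))
  have h2 := mfderiv_comp (I := 𝓘(ℝ, EK)) (I' := 𝓘(ℝ, EK)) (I'' := 𝓘(ℝ, E)) (1 : K)
    (g := fun a : K => (a : K ⧸ H)) (f := fun k : K => z * k * z⁻¹)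
    (hFs.mdifferentiableAt (by simp)) ((contMDiff_conj z).mdifferentiableAt (by simp))
  have h3 : (fun y : K ⧸ H => z • y) ∘ (fun a : K => (a : K ⧸ H)) =
      (fun a : K => (a : K ⧸ H)) ∘ (fun k : K => z * k * z⁻¹) := by
    ext k
    change ((z * k : K) : K ⧸ H) = ((z * k * z⁻¹ : K) : K ⧸ H)
    rw [QuotientGroup.eq]
    simpa [mul_assoc] using hz
  have h4 : (mfderiv 𝓘(ℝ, EK) 𝓘(ℝ, E) (fun a : K => (a : K ⧸ H)) (z * 1 * z⁻¹) : EK →L[ℝ] E) =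
      projDeriv EK H E := by rw [show z * 1 * z⁻¹ = (1 : K) by simp]; rfl
  refine h1.symm.trans (Eq.trans ?_ (h2.trans ?_))
  · rw [h3]
  · exact congrArg (fun A : EK →L[ℝ] E => A ∘L adjoint EK z) h4

/-- A torus has no nonzero fixed vector in the tangent space at the base point of the quotient by
its centralizer. -/
theorem eq_zero_of_isotropy_eq [FiniteDimensional ℝ EK] [FiniteDimensional ℝ E] [T2Space K]
    {Z : Subgroup K} [CompactSpace Z] (hZH : Z ≤ H) (hH : H = Subgroup.centralizer (Z : Set K))
    (hF : Manifold.IsSubmersion 𝓘(ℝ, EK) 𝓘(ℝ, E) ∞ (fun a : K => (a : K ⧸ H)))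
    (hFs : ContMDiff 𝓘(ℝ, EK) 𝓘(ℝ, E) ∞ (fun a : K => (a : K ⧸ H))) (v : E)
    (hv : ∀ z ∈ Z, isotropy H E z v = v) : v = 0 := by
  have hs := contMDiff_smul_quotient hF hFs
  obtain ⟨X, hX⟩ : ∃ X : EK, projDeriv EK H E X = v :=
    mfderiv_surjective_of_isSubmersion hF hFs 1 v
  have hXZ : ∀ z ∈ Z, projDeriv EK H E (adjoint EK z X) = projDeriv EK H E X := fun z hz => by
    rw [← ContinuousLinearMap.comp_apply, ← isotropy_comp_projDeriv hFs hs (hZH hz),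
      ContinuousLinearMap.comp_apply, hX, hv z hz]
  obtain ⟨Y, hYZ, hY⟩ := exists_adjoint_average Z (projDeriv EK H E) X hXZ
  obtain ⟨γ, hγ0, hγ, hγZ⟩ := exists_curve_commute_of_adjoint_eq (Z : Set K) Y hYZ
  have h1 : HasMFDerivAt 𝓘(ℝ, EK) 𝓘(ℝ, E) (fun a : K => (a : K ⧸ H)) (γ 0)
      (projDeriv EK H E) := by
    rw [hγ0]
    exact (hFs.mdifferentiableAt (by simp)).hasMFDerivAt
  -- The projected curve has velocity the image of Y, which is v; it is also locally constant,
  -- because γ(t) lies in `H` for small t.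
  have h2 := h1.comp 0 hγ
  have h3 : HasMFDerivAt 𝓘(ℝ, ℝ) 𝓘(ℝ, E) ((fun a : K => (a : K ⧸ H)) ∘ γ) 0 (0 : ℝ →L[ℝ] E) := by
    refine (hasMFDerivAt_const ((1 : K) : K ⧸ H) (0 : ℝ)).congr_of_eventuallyEq ?_
    filter_upwards [hγZ] with t ht
    change ((γ t : K) : K ⧸ H) = ((1 : K) : K ⧸ H)
    rw [eq_comm, QuotientGroup.eq]
    have h4 : γ t ∈ Subgroup.centralizer (Z : Set K) := Subgroup.mem_centralizer_iff.2 ht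
    rw [hH]
    simpa using h4
  have h4 : projDeriv EK H E ∘L ((1 : ℝ →L[ℝ] ℝ).smulRight Y) = (0 : ℝ →L[ℝ] E) :=
    hasMFDerivAt_unique h2 h3
  have h5 := congrArg (fun A : ℝ →L[ℝ] E => A 1) h4
  simp only [ContinuousLinearMap.comp_apply, ContinuousLinearMap.smulRight_apply,
    one_apply_eq_self, one_smul, zero_apply] at h5
  rw [← hX, ← hY, h5]

end Homogeneous

/-! ### Invariance of the fundamental form and the main theorem -/

theorem HermitianMetric.fundamentalForm_invariant {E : Type*} [NormedAddCommGroup E]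
    [NormedSpace ℝ E] {M : Type*} [TopologicalSpace M] [ChartedSpace E M]
    [IsManifold 𝓘(ℝ, E) ∞ M] {C : ComplexStructure E M} {h : HermitianMetric C} {K : Type*}
    [SMul K M] (hC : C.IsInvariant K) (hh : h.IsInvariant K) (a : K) (x : M) :
    (h.fundamentalForm (a • x)).compContinuousLinearMap
      (mfderiv 𝓘(ℝ, E) 𝓘(ℝ, E) (fun y : M => a • y) x) = h.fundamentalForm x := by
  ext v
  refine Eq.trans ?_ (hh a x (C.J x (v 0)) (v 1))
  rw [hC]
  rfl

end FlagBalanced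

end

theorem mainTheorem11
    {EK : Type*} [NormedAddCommGroup EK] [NormedSpace ℝ EK] [FiniteDimensional ℝ EK]
    {K : Type*} [TopologicalSpace K] [ChartedSpace EK K] [Group K] [LieGroup 𝓘(ℝ, EK) ∞ K]
    [T2Space K] [CompactSpace K] [ConnectedSpace K]
    (hK : FlagBalanced.IsSemisimpleLieGroup EK K)
    (Z H : Subgroup K) (hZ : FlagBalanced.IsTorus Z) (hH : H = Subgroup.centralizer (Z : Set K))
    {E : Type*} [NormedAddCommGroup E] [NormedSpace ℝ E] [FiniteDimensional ℝ E]
    [ChartedSpace E (K ⧸ H)] [IsManifold 𝓘(ℝ, E) ∞ (K ⧸ H)]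
    (hF : Manifold.IsSubmersion 𝓘(ℝ, EK) 𝓘(ℝ, E) ∞ (fun a : K => (a : K ⧸ H)))
    (n : ℕ) (hn : Module.finrank ℝ E = 2 * n)
    (C : FlagBalanced.ComplexStructure E (K ⧸ H)) (hC : C.IsInvariant K)
    (h : FlagBalanced.HermitianMetric C) (hh : h.IsInvariant K) :
    h.IsBalanced n := by
  have hZc : CompactSpace Z := hZ.compactSpace
  have hZH : Z ≤ H := by
    intro z hz
    rw [hH, Subgroup.mem_centralizer_iff]
    intro w hw
    exact congrArg Subtype.val (hZ.mul_comm ⟨w, hw⟩ ⟨z, hz⟩)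
  have hFs : ContMDiff 𝓘(ℝ, EK) 𝓘(ℝ, E) ∞ (fun a : K => (a : K ⧸ H)) := hF.contMDiff
  have hs := FlagBalanced.contMDiff_smul_quotient hF hFs
  set α : FlagBalanced.DiffForm E (K ⧸ H) (2 * (n - 1)) :=
    fun x => FlagBalanced.wedgePow (h.fundamentalForm x) (n - 1) with hα
  have hαinv : ∀ (a : K) (x : K ⧸ H), (α (a • x)).compContinuousLinearMap
      (mfderiv 𝓘(ℝ, E) 𝓘(ℝ, E) (fun y : K ⧸ H => a • y) x) = α x := fun a x => by
    simp only [hα]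
    rw [FlagBalanced.wedgePow_compContinuousLinearMap,
      FlagBalanced.HermitianMetric.fundamentalForm_invariant hC hh]
  have hβinv : ∀ (a : K) (x : K ⧸ H), (FlagBalanced.extDer α (a • x)).compContinuousLinearMap
      (mfderiv 𝓘(ℝ, E) 𝓘(ℝ, E) (fun y : K ⧸ H => a • y) x) = FlagBalanced.extDer α x :=
    fun a x => FlagBalanced.extDer_invariant α (hs a) (hs a⁻¹) (inv_smul_smul a)
      (smul_inv_smul a) (hαinv a) x
  have hbase : FlagBalanced.extDer α ((1 : K) : K ⧸ H) = 0 := by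
    let β : E [⋀^Fin (2 * (n - 1) + 1)]→L[ℝ] ℝ := FlagBalanced.extDer α ((1 : K) : K ⧸ H)
    suffices hβ : β.toAlternatingMap = 0 from
      ContinuousAlternatingMap.toAlternatingMap_injective hβ
    -- For n = 0 truncated subtraction makes β a 1-form, not one of codegree one; it vanishes
    -- because the tangent space is zero.
    rcases Nat.eq_zero_or_pos n with rfl | hn0
    · have hE : Subsingleton E := Module.finrank_zero_iff.1 hn
      ext v
      exact β.map_coord_zero 0 (Subsingleton.elim _ _)
    by_contra hβ
    let g : E →L[ℝ] E →L[ℝ] ℝ := h.g.inner ((1 : K) : K ⧸ H)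
    obtain ⟨v, hv, hfix⟩ := FlagBalanced.exists_ne_zero_forall_apply_eq
      (show Module.finrank ℝ E = 2 * (n - 1) + 1 + 1 by omega) β.toAlternatingMap hβ (fun v w => g v w)
      (fun r v => by
        rw [map_smul, map_smul, smul_apply, smul_eq_mul, smul_eq_mul, ← mul_assoc, sq])
      (fun v hv => h.g.pos _ v hv)
      (fun z : Z => (FlagBalanced.isotropy H E (z : K)).toLinearMap)
      (fun z v => by
        have h1 := hh (z : K) ((1 : K) : K ⧸ H) v v
        have h2 : (h.g.inner ((z : K) • ((1 : K) : K ⧸ H)) : E →L[ℝ] E →L[ℝ] ℝ) = g := by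
          rw [FlagBalanced.smul_base (hZH z.2)]
        exact (congrArg (fun b : E →L[ℝ] E →L[ℝ] ℝ => b (FlagBalanced.isotropy H E (z : K) v)
          (FlagBalanced.isotropy H E (z : K) v)) h2.symm).trans h1)
      (fun z => by
        have h1 := hβinv (z : K) ((1 : K) : K ⧸ H)
        have h2 : (FlagBalanced.extDer α ((z : K) • ((1 : K) : K ⧸ H)) :
            E [⋀^Fin (2 * (n - 1) + 1)]→L[ℝ] ℝ) = β := by
          rw [FlagBalanced.smul_base (hZH z.2)]
        have h3 : β.compContinuousLinearMap (FlagBalanced.isotropy H E (z : K)) = β := by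
          refine Eq.trans ?_ h1
          exact congrArg (fun b : E [⋀^Fin (2 * (n - 1) + 1)]→L[ℝ] ℝ =>
            b.compContinuousLinearMap _) h2.symm
        exact congrArg ContinuousAlternatingMap.toAlternatingMap h3)
      (fun z => by
        obtain ⟨w, rfl⟩ := hZ.exists_mul_self z
        refine ⟨w, ?_⟩
        rw [Subgroup.coe_mul, FlagBalanced.isotropy_mul hs _ (hZH w.2)]
        rfl)
    exact hv (FlagBalanced.eq_zero_of_isotropy_eq hZH hH hF hFs v fun z hz => hfix ⟨z, hz⟩)
  funext x
  obtain ⟨a, rfl⟩ := Quotient.mk_surjective x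
  change FlagBalanced.extDer α ((a : K) : K ⧸ H) = 0
  -- Transitivity: translation by a⁻¹ carries aH to the base point, so β at aH is the pullback of 0.
  have h1 := hβinv a⁻¹ ((a : K) : K ⧸ H)
  have h2 : (FlagBalanced.extDer α (a⁻¹ • ((a : K) : K ⧸ H)) :
      E [⋀^Fin (2 * (n - 1) + 1)]→L[ℝ] ℝ) = 0 := by
    rw [show a⁻¹ • ((a : K) : K ⧸ H) = ((1 : K) : K ⧸ H) from
      congrArg QuotientGroup.mk (inv_mul_cancel a)]
    exact hbase
  rw [← h1]
  exact congrArg (fun b : E [⋀^Fin (2 * (n - 1) + 1)]→L[ℝ] ℝ => b.compContinuousLinearMap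
    (mfderiv 𝓘(ℝ, E) 𝓘(ℝ, E) (fun y : K ⧸ H => a⁻¹ • y) ((a : K) : K ⧸ H) : E →L[ℝ] E)) h2
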